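/- Let $k\ge 1$, let $F$ be a field, and let $V_1,\dots,V_k$ be finite-dimensional $F$-vector spaces with bases $B_i=(b_{i,s})_{s\in S_i}$ indexed by finite sets $S_i$. Let $v\in V_1\otimes\dots\otimes V_k$, and let $\Gamma\subseteq S_1\times\dots\times S_k$ be its support with respect to $B=(B_1,\dots,B_k)$, i.e. the set of all $(s_1,\dots,s_k)$ such that the coefficient of $v$ at $b_{1,s_1}\otimes\dots\otimes b_{k,s_k}$ is nonzero. For total orders $\sigma_i$ on $S_i$ $(1\le i\le k)$ let $\sigma=\sigma_1\times\dots\times\sigma_k$ be the product partial order on $S_1\times\dots\times S_k$, and let $\Gamma_\sigma$ be the set of $\sigma$-maximal elements of $\Gamma$. For a finite set $\Delta\subseteq S_1\times\dots\times S_k$ let $$H(\Delta)=\sup_{(X_1,\dots,X_k)}\min\bigl(h(X_1),\dots,h(X_k)\bigr),$$ where $(X_1,\dots,X_k)$ ranges over the random variables with values in $\Delta$ and $h(X)=-\sum_\alpha p_\alpha\log p_\alpha$, $p_\alpha=\Pr(X=\alpha)$, is the Shannon entropy (natural logarithm, $0\log 0=0$); $H(\emptyset)=0$. A slice tensor in $W_1\otimes\dots\otimes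 W_k$ is a tensor of the form $w\otimes_j y$ with $1\le j\le k$, $w\in W_j$ and $y\in\bigotimes_{i\ne j}W_i$, where $\otimes_j$ denotes the tensor product with $w$ placed in the $j$-th position. The slice rank $\operatorname{rank}(t)$ of a tensor $t\in W_1\otimes\dots\otimes W_k$ is the least $r\ge 0$ such that $t$ is a linear combination of $r$ slice tensors. The tensor power $v^{\otimes n}$ is regarded as a $k$-tensor in $V_1^{\otimes n}\otimes\dots\otimes V_k^{\otimes n}$. Put $\xi_k=\log\bigl(k/(k-1)^{(k-1)/k}\bigr)$ (with $0^0=1$). If there exists a product order $\sigma$ with $H(\Gamma_\sigma)\ne 0$, then $$\operatorname{rank}(v^{\otimes n})\ \ge\ \exp\bigl(\xi_k\,(n+o(n))\bigr),$$ that is, there is a function $e:\mathbb N\to\mathbb R$ with $e(n)/n\to 0$ as $n\to\infty$ such that $\operatorname{rank}(v^{\otimes n})\ge\exp\bigl(\xi_k(n+e(n))\bigr)$ for all $n$. -/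

import Mathlib

open scoped TensorProduct
open Asymptotics Filter

noncomputable section SliceRankDefs

universe u v w

/-! ### Slice tensors and slice rank -/

/-- A tensor in `⨂ i, W i` is a *slice tensor* if, for some `j`, it is the `j`-th tensor product
`x ⊗ⱼ y` of some `x : W j` and some `y` in the tensor product of the `W i` with `i ≠ j`. -/
def IsSliceTensor {k : ℕ} {F : Type u} [Field F] {W : Fin k → Type v}
    [∀ i, AddCommGroup (W i)] [∀ i, Module F (W i)] (t : ⨂[F] i, W i) : Prop :=
  ∃ (j : Fin k) (x : W j) (y : ⨂[F] i : ({j}ᶜ : Set (Fin k)), W i),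
    t = (PiTensorProduct.equivPiTensorComplSingletonTensor F W j).symm (y ⊗ₜ[F] x)

/-- The slice rank of `t`: the least `r` such that `t` is a linear combination of `r` slice
tensors. -/
def sliceRank {k : ℕ} {F : Type u} [Field F] {W : Fin k → Type v}
    [∀ i, AddCommGroup (W i)] [∀ i, Module F (W i)] (t : ⨂[F] i, W i) : ℕ :=
  sInf {r : ℕ | ∃ (c : Fin r → F) (s : Fin r → ⨂[F] i, W i),
    (∀ a, IsSliceTensor (s a)) ∧ t = ∑ a, c a • s a}

/-! ### Tensor powers of a `k`-tensor, as `k`-tensors over the spaces `V i ^ ⊗ n` -/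

/-- The bilinear map `V^{⊗ n} × V → V^{⊗ (n+1)}` that appends a factor on the right. -/
def tensorPowerSnoc (F : Type u) [Field F] (M : Type v) [AddCommGroup M] [Module F M] (n : ℕ) :
    (⨂[F]^n M) →ₗ[F] M →ₗ[F] (⨂[F]^(n + 1) M) :=
  ((TensorProduct.mk F (⨂[F]^n M) (⨂[F]^1 M)).compr₂
    (TensorPower.mulEquiv (R := F) (M := M) (n := n) (m := 1)).toLinearMap).compl₂
      (PiTensorProduct.subsingletonEquiv (R := F) (s := fun _ : Fin 1 => M) 0).symm.toLinearMap

/-- The `n`-th tensor power `t^{⊗ n}` of `t ∈ ⨂ i, V i`, regarded as a `k`-tensor in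
`⨂ i, (V i)^{⊗ n}`: the `n`-th copies of the factor `V i` are grouped together for each `i`. -/
def kTensorPow {k : ℕ} {F : Type u} [Field F] {V : Fin k → Type v}
    [∀ i, AddCommGroup (V i)] [∀ i, Module F (V i)] (t : ⨂[F] i, V i) :
    (n : ℕ) → ⨂[F] i, ⨂[F]^n (V i)
  | 0 => PiTensorProduct.tprod F fun _ => PiTensorProduct.tprod F Fin.elim0
  | n + 1 => PiTensorProduct.map₂ (fun i => tensorPowerSnoc F (V i) n) (kTensorPow t n) t

/-! ### Supports, maximal elements and entropy -/

/-- The support of `t` with respect to the bases `b i` of the `V i`: the set of all index tuples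
`s` such that the coefficient of `t` at `⨂ i, b i (s i)` is nonzero. -/
def tensorSupport {k : ℕ} {F : Type u} [Field F] {V : Fin k → Type v}
    [∀ i, AddCommGroup (V i)] [∀ i, Module F (V i)] {S : Fin k → Type w}
    (b : ∀ i, Module.Basis (S i) F (V i)) (t : ⨂[F] i, V i) : Finset (∀ i, S i) :=
  ((Basis.piTensorProduct b).repr t).support

open Classical in
/-- The set `Γ_σ` of maximal elements of `Γ` with respect to the product (that is, coordinatewise)
partial order of the total orders `σ i`. -/
def maxElements {k : ℕ} {S : Fin k → Type w} (σ : ∀ i, LinearOrder (S i))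
    (Γ : Finset (∀ i, S i)) : Finset (∀ i, S i) :=
  {x ∈ Γ | ∀ y ∈ Γ, (∀ i, (σ i).le (x i) (y i)) → y = x}

open Classical in
/-- The Shannon entropy (natural logarithm, `0 log 0 = 0`) of the `i`-th coordinate of a random
element of `Γ` with law `p`. -/
def coordEntropy {k : ℕ} {S : Fin k → Type w} [∀ i, Fintype (S i)] {Γ : Finset (∀ i, S i)}
    (p : Γ → ℝ) (i : Fin k) : ℝ :=
  ∑ α : S i, Real.negMulLog (∑ s : Γ with s.1 i = α, p s)

/-- `H(Γ)`: the supremum, over all probability distributions on `Γ`, of the least entropy of a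
coordinate. (For empty `Γ` there is no distribution and the value is `0`.) -/
def setEntropy {k : ℕ} {S : Fin k → Type w} [∀ i, Fintype (S i)]
    (Γ : Finset (∀ i, S i)) : ℝ :=
  ⨆ p : stdSimplex ℝ Γ, ⨅ i : Fin k, coordEntropy p.1 i

/-- `ξ_k = log (k / (k-1)^{(k-1)/k})`. -/
def gapConst (k : ℕ) : ℝ :=
  Real.log ((k : ℝ) / ((k : ℝ) - 1) ^ (((k : ℝ) - 1) / (k : ℝ)))

end SliceRankDefs

/-!
The constant `gapConst k` is the binary entropy of `1 / k` (`gapConst_eq_binEntropy`), so the claim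
is that the slice rank of `v^{⊗ n}` is at least `n.choose (n / k)` up to a factor `exp (o(n))`.

Let `Δ` be the set of `σ`-maximal elements of the support of `v`. If `Δ` has nonzero entropy, then
no coordinate is constant on `Δ`, and since `Δ` is an antichain this forces `k ≥ 2`. A subset of `Δ`
that is minimal among those on which no coordinate is constant has at most `k` elements
(`exists_fin_family_nonconstant`), so it is enumerated by a family `f : Fin k → Δ`. Repeat `f`
periodically to get a word of length `n` in `Δ`. In each coordinate, two distinct letters occur at
least `n / k` times each, so that some letter occurs between `n / k` and `n - n / k` times. The same
holds for all rearrangements of the word by permutations of its `n` positions.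

By the Tao–Sawin argument (`exists_cover_card_le_sliceRank`) the maximal elements of the support of
a tensor of slice rank `r` are covered by `r` hyperplanes, for any total orders on the bases. For
`v^{⊗ n}` and the lexicographic orders, all words in `Δ` are maximal in the support
(`mem_maxElements_lex`), in particular the rearrangements above. Counting permutations
(`le_sum_card_of_forall_perm`) shows that covering these takes at least `n.choose a` hyperplanes for
some `a` between `n / k` and `n - n / k`, and the usual entropy bound for binomial coefficients
(`exp_mul_binEntropy_le`) finishes the proof.
-/

/-! ### Functionals in echelon form -/

/-- Linear functionals killing a subspace `U`, in echelon form with respect to an ordered basis: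
with at most `dim U` exceptions, every index `s` is the least one at which some functional vanishing on
`U` is nonzero. The exceptions are the largest indices occurring in nonzero elements of `U`. -/
lemma exists_finset_triangular_dual {F V S : Type*} [Field F] [AddCommGroup V] [Module F V]
    [Fintype S] [LinearOrder S] (b : Module.Basis S F V) (U : Submodule F V) :
    ∃ A : Finset S, A.card ≤ Module.finrank F U ∧ ∀ s ∉ A, ∃ φ : V →ₗ[F] F,
      U ≤ LinearMap.ker φ ∧ φ (b s) ≠ 0 ∧ ∀ t < s, φ (b t) = 0 := by
  classical
  have : FiniteDimensional F V := b.finiteDimensional_of_finite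
  refine ⟨Finset.univ.filter fun s ↦ b s ∈ U ⊔ Submodule.span F (b '' Set.Iio s), ?_,
    fun s hs ↦ ?_⟩
  · set A : Finset S := Finset.univ.filter fun s ↦ b s ∈ U ⊔ Submodule.span F (b '' Set.Iio s)
      with hA
    -- Elements of `U` whose largest index is `s`, for each `s ∈ A`; they are linearly independent.
    have key : ∀ s : A, ∃ u : U, b.repr u s = 1 ∧ ∀ t > s.1, b.repr u t = 0 := by
      rintro ⟨s, hs⟩
      obtain ⟨u, hu, y, hy, huy⟩ := Submodule.mem_sup.1 (Finset.mem_filter.1 hs).2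
      have hy0 : ∀ t, s ≤ t → b.repr y t = 0 := fun t ht ↦ by
        by_contra h
        exact absurd ((b.mem_span_image.1 hy) (Finsupp.mem_support_iff.2 h)) (by simpa using ht)
      obtain rfl : u = b s - y := eq_sub_of_add_eq huy
      refine ⟨⟨_, hu⟩, by simp [hy0 s le_rfl], fun t ht ↦ ?_⟩
      have hst : s < t := ht
      simp [hy0 t hst.le, hst.ne]
    choose u hu1 hu0 using key
    have hli : LinearIndependent F u := by
      rw [Fintype.linearIndependent_iff]
      intro g hg
      by_contra! hne
      obtain ⟨i, hi⟩ := hne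
      obtain ⟨m, hm, hmax⟩ := (Finset.univ.filter fun i ↦ g i ≠ 0).exists_max_image
        (fun i : A ↦ i.1) ⟨i, by simpa using hi⟩
      have h := congrArg (fun x : U ↦ b.repr x m) hg
      simp only [Submodule.coe_sum, map_sum, Finsupp.coe_finsetSum, Finset.sum_apply,
        Submodule.coe_smul, map_smul, Finsupp.smul_apply, smul_eq_mul, Submodule.coe_zero,
        map_zero, Finsupp.coe_zero, Pi.zero_apply] at h
      rw [Finset.sum_eq_single m] at h
      · simp [hu1] at h
        simp [h] at hm
      · intro j _ hj
        by_cases hgj : g j = 0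
        · simp [hgj]
        · have hle := hmax j (by simpa using hgj)
          rw [hu0 j m (lt_of_le_of_ne hle fun e ↦ hj (Subtype.ext e)), mul_zero]
      · simp
    simpa using hli.fintype_card_le_finrank
  · obtain ⟨φ, hφ, hle⟩ := Submodule.exists_le_ker_of_notMem
      (show b s ∉ U ⊔ Submodule.span F (b '' Set.Iio s) by simpa using hs)
    exact ⟨φ, le_sup_left.trans hle, hφ, fun t ht ↦
      hle (Submodule.mem_sup_right (Submodule.subset_span ⟨t, ht, rfl⟩))⟩

/-! ### Slice rank and covers of the maximal support -/

/-- The tensor product of a family of linear functionals. -/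
noncomputable def tprodDual {F : Type*} [Field F] {ι : Type*} [Fintype ι] {W : ι → Type*}
    [∀ i, AddCommGroup (W i)] [∀ i, Module F (W i)] (φ : ∀ i, W i →ₗ[F] F) :
    (⨂[F] i, W i) →ₗ[F] F :=
  PiTensorProduct.lift ((MultilinearMap.mkPiAlgebra F ι F).compLinearMap φ)

@[simp]
lemma tprodDual_tprod {F : Type*} [Field F] {ι : Type*} [Fintype ι] {W : ι → Type*}
    [∀ i, AddCommGroup (W i)] [∀ i, Module F (W i)] (φ : ∀ i, W i →ₗ[F] F) (x : ∀ i, W i) :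
    tprodDual φ (PiTensorProduct.tprod F x) = ∏ i, φ i (x i) := by
  simp [tprodDual]

/-- A tensor product of functionals kills the slice tensor `x ⊗ⱼ y` as soon as its `j`-th factor
kills `x`. -/
lemma tprodDual_sliceTensor {k : ℕ} {F : Type*} [Field F] {W : Fin k → Type*}
    [∀ i, AddCommGroup (W i)] [∀ i, Module F (W i)] (φ : ∀ i, W i →ₗ[F] F) (j : Fin k)
    {x : W j} (hx : φ j x = 0) (y : ⨂[F] i : ({j}ᶜ : Set (Fin k)), W i) :
    tprodDual φ ((PiTensorProduct.equivPiTensorComplSingletonTensor F W j).symm (y ⊗ₜ[F] x)) =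
      0 := by
  induction y using PiTensorProduct.induction_on with
  | smul_tprod r m =>
    rw [← TensorProduct.smul_tmul', map_smul, map_smul]
    erw [PiTensorProduct.equivPiTensorComplSingletonTensor_symm_tmul F W j m x]
    rw [tprodDual_tprod, Finset.prod_eq_zero (Finset.mem_univ j), smul_zero]
    exact (congrArg (φ j) (Function.subtypeNeLift_self (M := W) j m x)).trans hx
  | add a b ha hb => rw [TensorProduct.add_tmul, map_add, map_add, ha, hb, add_zero]

lemma isSliceTensor_smul_tprod {k : ℕ} (hk : 1 ≤ k) {F : Type*} [Field F] {W : Fin k → Type*}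
    [∀ i, AddCommGroup (W i)] [∀ i, Module F (W i)] (r : F) (x : ∀ i, W i) :
    IsSliceTensor (r • PiTensorProduct.tprod F x) := by
  refine ⟨⟨0, hk⟩, x _,
    r • PiTensorProduct.tprod F fun i : ({⟨0, hk⟩}ᶜ : Set (Fin k)) ↦ x i, ?_⟩
  rw [LinearEquiv.eq_symm_apply, map_smul,
    PiTensorProduct.equivPiTensorComplSingletonTensor_tprod, ← TensorProduct.smul_tmul']
  rfl

lemma exists_sum_sliceTensor {k : ℕ} (hk : 1 ≤ k) {F : Type*} [Field F] {W : Fin k → Type*}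
    [∀ i, AddCommGroup (W i)] [∀ i, Module F (W i)] (t : ⨂[F] i, W i) :
    ∃ (r : ℕ) (c : Fin r → F) (s : Fin r → ⨂[F] i, W i),
      (∀ a, IsSliceTensor (s a)) ∧ t = ∑ a, c a • s a := by
  induction t using PiTensorProduct.induction_on with
  | smul_tprod r x =>
    exact ⟨1, 1, fun _ ↦ r • PiTensorProduct.tprod F x,
      fun _ ↦ isSliceTensor_smul_tprod hk r x, by simp⟩
  | add t u ht hu =>
    obtain ⟨r, c, s, hs, rfl⟩ := ht
    obtain ⟨r', c', s', hs', rfl⟩ := hu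
    refine ⟨r + r', Fin.append c c', Fin.append s s', fun a ↦ ?_, by simp [Fin.sum_univ_add]⟩
    induction a using Fin.addCases with
    | left a => simpa using hs a
    | right a => simpa using hs' a

/-- The infimum defining the slice rank is attained. For `k = 0` there are no slice tensors, and the
infimum is that of the empty set unless the tensor is zero. -/
lemma exists_sum_sliceTensor_sliceRank {k : ℕ} (hk : 1 ≤ k) {F : Type*} [Field F]
    {W : Fin k → Type*} [∀ i, AddCommGroup (W i)] [∀ i, Module F (W i)] (t : ⨂[F] i, W i) :
    ∃ (c : Fin (sliceRank t) → F) (s : Fin (sliceRank t) → ⨂[F] i, W i),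
      (∀ a, IsSliceTensor (s a)) ∧ t = ∑ a, c a • s a :=
  Nat.sInf_mem (s := {r | ∃ (c : Fin r → F) (s : Fin r → ⨂[F] i, W i),
    (∀ a, IsSliceTensor (s a)) ∧ t = ∑ a, c a • s a}) (exists_sum_sliceTensor hk t)

lemma mem_maxElements {k : ℕ} {S : Fin k → Type*} {σ : ∀ i, LinearOrder (S i)}
    {Γ : Finset (∀ i, S i)} {x : ∀ i, S i} :
    x ∈ maxElements σ Γ ↔ x ∈ Γ ∧ ∀ y ∈ Γ, (∀ i, (σ i).le (x i) (y i)) → y = x := by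
  simp [maxElements]

/-- The Tao–Sawin lower bound: the maximal elements of the support of a tensor can be covered by
`sliceRank t` hyperplanes `{x | x i = s}`. If some maximal `z` were not covered, a tensor product of
functionals with least indices `z i` would kill every slice of a decomposition of `t`, while of
all terms of `t` it sees only the one at `z`. -/
theorem exists_cover_card_le_sliceRank {k : ℕ} (hk : 1 ≤ k) {F : Type*} [Field F]
    {W : Fin k → Type*} [∀ i, AddCommGroup (W i)] [∀ i, Module F (W i)] {S : Fin k → Type*}
    [∀ i, Fintype (S i)] (σ : ∀ i, LinearOrder (S i)) (b : ∀ i, Module.Basis (S i) F (W i))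
    (t : ⨂[F] i, W i) :
    ∃ A : ∀ i, Finset (S i), ∑ i, (A i).card ≤ sliceRank t ∧
      ∀ x ∈ maxElements σ (tensorSupport b t), ∃ i, x i ∈ A i := by
  classical
  obtain ⟨c, s, hs, ht⟩ := exists_sum_sliceTensor_sliceRank hk t
  choose j x y hs using hs
  have hA := fun i ↦ @exists_finset_triangular_dual F (W i) (S i) _ _ _ _ (σ i) (b i)
    (Submodule.span F
      (Finset.image (fun a : {a // j a = i} ↦ a.2 ▸ x a.1) Finset.univ : Finset (W i)))
  choose A hcard hdual using hA
  refine ⟨A, ?_, fun z hz ↦ ?_⟩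
  · calc ∑ i, (A i).card ≤ ∑ i, Fintype.card {a // j a = i} := Finset.sum_le_sum fun i _ ↦
          (hcard i).trans ((finrank_span_finset_le_card _).trans Finset.card_image_le)
      _ = sliceRank t := by
        rw [← Fintype.card_sigma, Fintype.card_congr (Equiv.sigmaFiberEquiv j), Fintype.card_fin]
  · by_contra! hzA
    choose φ hker hne hlt using fun i ↦ hdual i (z i) (hzA i)
    have h0 : tprodDual φ t = 0 := by
      rw [ht, map_sum]
      refine Finset.sum_eq_zero fun a _ ↦ ?_
      rw [map_smul, hs a, tprodDual_sliceTensor φ (j a), smul_zero]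
      exact hker (j a) (Submodule.subset_span (Finset.mem_coe.2 (Finset.mem_image.2
        ⟨⟨a, rfl⟩, Finset.mem_univ _, rfl⟩)))
    obtain ⟨hzs, hmax⟩ := mem_maxElements.1 hz
    -- The other terms of `t` vanish: where `φ i` does not vanish, the index is at least `z i`.
    have h1 : tprodDual φ t = (Basis.piTensorProduct b).repr t z * ∏ i, φ i (b i (z i)) := by
      conv_lhs => rw [← (Basis.piTensorProduct b).sum_repr t, map_sum]
      rw [Finset.sum_eq_single z]
      · simp
      · intro w _ hwz
        rw [map_smul, Basis.piTensorProduct_apply, tprodDual_tprod, smul_eq_mul, mul_eq_zero,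
          or_iff_not_imp_left]
        intro hw
        have : ¬ ∀ i, (σ i).le (z i) (w i) := fun hle ↦
          hwz (hmax w (Finsupp.mem_support_iff.2 hw) hle)
        obtain ⟨i, hi⟩ := not_forall.1 this
        exact Finset.prod_eq_zero (Finset.mem_univ i)
          (hlt i _ ((@not_le _ (σ i) _ _).1 hi))
      · simp
    exact mul_ne_zero (Finsupp.mem_support_iff.1 hzs)
      (Finset.prod_ne_zero_iff.2 fun i _ ↦ hne i) (h1.symm.trans h0)

/-! ### Coefficients of tensor powers -/

lemma tensorPowerSnoc_tprod {F M : Type*} [Field F] [AddCommGroup M] [Module F M] {n : ℕ}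
    (x : Fin n → M) (y : M) :
    tensorPowerSnoc F M n (PiTensorProduct.tprod F x) y =
      PiTensorProduct.tprod F (Fin.snoc x y : Fin (n + 1) → M) := by
  simp only [tensorPowerSnoc, LinearMap.compl₂_apply, LinearMap.compr₂_apply,
    LinearEquiv.coe_coe, TensorProduct.mk_apply, PiTensorProduct.subsingletonEquiv_symm_apply']
  refine (TensorPower.tprod_mul_tprod F x fun _ : Fin 1 ↦ y).trans ?_
  rw [Fin.append_right_eq_snoc]

/-- The basis of `V^{⊗ n}` given by the pure tensors in the elements of a basis of `V`. -/
noncomputable abbrev tensorPowerBasis {F V S : Type*} [Field F] [AddCommGroup V] [Module F V]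
    (b : Module.Basis S F V) (n : ℕ) : Module.Basis (Fin n → S) F (⨂[F]^n V) :=
  Basis.piTensorProduct fun _ ↦ b

lemma tensorPowerBasis_repr_snoc {F V S : Type*} [Field F] [AddCommGroup V] [Module F V]
    (b : Module.Basis S F V) {n : ℕ} (x : ⨂[F]^n V) (y : V) (w : Fin (n + 1) → S) :
    (tensorPowerBasis b (n + 1)).repr (tensorPowerSnoc F V n x y) w =
      (tensorPowerBasis b n).repr x (fun l ↦ w l.castSucc) * b.repr y (w (Fin.last n)) := by
  induction x using PiTensorProduct.induction_on with
  | smul_tprod r x =>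
    simp [tensorPowerSnoc_tprod, Fin.prod_univ_castSucc, mul_assoc]
  | add x x' hx hx' => simp [hx, hx', add_mul]

lemma piTensorProduct_repr_map₂_snoc {k : ℕ} {F : Type*} [Field F] {V : Fin k → Type*}
    [∀ i, AddCommGroup (V i)] [∀ i, Module F (V i)] {S : Fin k → Type*}
    (b : ∀ i, Module.Basis (S i) F (V i)) {n : ℕ} (x : ⨂[F] i, ⨂[F]^n (V i)) (y : ⨂[F] i, V i)
    (w : ∀ i, Fin (n + 1) → S i) :
    (Basis.piTensorProduct fun i ↦ tensorPowerBasis (b i) (n + 1)).repr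
        (PiTensorProduct.map₂ (fun i ↦ tensorPowerSnoc F (V i) n) x y) w =
      (Basis.piTensorProduct fun i ↦ tensorPowerBasis (b i) n).repr x (fun i l ↦ w i l.castSucc) *
        (Basis.piTensorProduct b).repr y (fun i ↦ w i (Fin.last n)) := by
  induction x using PiTensorProduct.induction_on with
  | smul_tprod r x =>
    induction y using PiTensorProduct.induction_on with
    | smul_tprod r' y =>
      simp only [map_smul, LinearMap.smul_apply, PiTensorProduct.map₂_tprod_tprod,
        Finsupp.smul_apply, Basis.piTensorProduct_repr_tprod_apply, tensorPowerBasis_repr_snoc,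
        Finset.prod_mul_distrib, smul_eq_mul]
      ring
    | add y y' hy hy' => simp only [map_add, Finsupp.add_apply, hy, hy', mul_add]
  | add x x' hx hx' => simp only [map_add, LinearMap.add_apply, Finsupp.add_apply, hx, hx', add_mul]

lemma piTensorProduct_repr_kTensorPow {k : ℕ} {F : Type*} [Field F] {V : Fin k → Type*}
    [∀ i, AddCommGroup (V i)] [∀ i, Module F (V i)] {S : Fin k → Type*}
    (b : ∀ i, Module.Basis (S i) F (V i)) (t : ⨂[F] i, V i) (n : ℕ) (w : ∀ i, Fin n → S i) :
    (Basis.piTensorProduct fun i ↦ tensorPowerBasis (b i) n).repr (kTensorPow t n) w =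
      ∏ l, (Basis.piTensorProduct b).repr t (fun i ↦ w i l) := by
  induction n with
  | zero => simp [kTensorPow]
  | succ n ih => rw [kTensorPow, piTensorProduct_repr_map₂_snoc, ih, Fin.prod_univ_castSucc]

lemma mem_tensorSupport_kTensorPow {k : ℕ} {F : Type*} [Field F] {V : Fin k → Type*}
    [∀ i, AddCommGroup (V i)] [∀ i, Module F (V i)] {S : Fin k → Type*}
    (b : ∀ i, Module.Basis (S i) F (V i)) (t : ⨂[F] i, V i) (n : ℕ) (w : ∀ i, Fin n → S i) :
    w ∈ tensorSupport (fun i ↦ tensorPowerBasis (b i) n) (kTensorPow t n) ↔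
      ∀ l, (fun i ↦ w i l) ∈ tensorSupport b t := by
  simp only [tensorSupport, Finsupp.mem_support_iff, piTensorProduct_repr_kTensorPow, ne_eq,
    Finset.prod_eq_zero_iff, not_exists, Finset.mem_univ, true_and]

/-! ### Lexicographic orders on words -/

/-- The lexicographic order on words of length `n` (`Fin n → S` itself carries the pointwise order,
so this is not an instance). -/
@[reducible] noncomputable def lexLinearOrder {S : Type*} (σ : LinearOrder S) (n : ℕ) :
    LinearOrder (Fin n → S) :=
  inferInstanceAs (LinearOrder (Lex (Fin n → S)))

/-- For lexicographic orders, words in maximal elements of `Γ` are maximal among words in `Γ`: a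
word that is at least as large in every coordinate agrees with the given one letter by letter. -/
lemma mem_maxElements_lex {k : ℕ} {S : Fin k → Type*} (σ : ∀ i, LinearOrder (S i)) {n : ℕ}
    {Γ : Finset (∀ i, S i)} {Γn : Finset (∀ i, Fin n → S i)}
    (hΓ : ∀ w, w ∈ Γn ↔ ∀ l, (fun i ↦ w i l) ∈ Γ) {w : ∀ i, Fin n → S i}
    (hw : ∀ l, (fun i ↦ w i l) ∈ maxElements σ Γ) :
    w ∈ maxElements (fun i ↦ lexLinearOrder (σ i) n) Γn := by
  simp only [mem_maxElements] at hw ⊢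
  refine ⟨(hΓ w).2 fun l ↦ (hw l).1, fun z hz hle ↦ ?_⟩
  have key : ∀ l : Fin n, (fun i ↦ z i l) = fun i ↦ w i l := by
    intro l
    induction l using WellFoundedLT.induction with
    | ind l ih =>
      refine (hw l).2 _ ((hΓ z).1 hz l) fun i ↦ ?_
      let := σ i
      by_contra! hlt
      have : toLex (z i) < toLex (w i) := ⟨l, fun l' hl' ↦ congrFun (ih l' hl') i, hlt⟩
      exact absurd (show toLex (w i) ≤ toLex (z i) from hle i) this.not_ge
  ext i l
  exact congrFun (key l) i

/-! ### Separating families -/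

/-- If no coordinate is constant on `Δ`, then `k` elements suffice to witness this. In a subset of
least cardinality on which no coordinate is constant, removing an element makes some coordinate
constant; as soon as there are three elements, distinct elements have distinct such coordinates. -/
lemma exists_fin_family_nonconstant {k : ℕ} (hk : 2 ≤ k) {S : Fin k → Type*}
    {Δ : Finset (∀ i, S i)} (hΔ : ∀ i, ∃ x ∈ Δ, ∃ y ∈ Δ, x i ≠ y i) :
    ∃ e : Fin k → ∀ i, S i, (∀ a, e a ∈ Δ) ∧ ∀ i, ∃ a b, e a i ≠ e b i := by
  classical
  obtain ⟨T, hT, hmin⟩ := (Δ.powerset.filter fun T ↦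
    ∀ i, ∃ x ∈ T, ∃ y ∈ T, x i ≠ y i).exists_min_image Finset.card ⟨Δ, by simpa using hΔ⟩
  simp only [Finset.mem_filter, Finset.mem_powerset, and_imp] at hT hmin
  obtain ⟨hTΔ, hT⟩ := hT
  have hcard : T.card ≤ k := by
    by_contra! hlt
    have hconst : ∀ t : T, ∃ i, ∀ x ∈ T.erase t, ∀ y ∈ T.erase t, x i = y i := by
      intro t
      by_contra! h
      exact absurd (hmin (T.erase t) ((Finset.erase_subset _ _).trans hTΔ) h)
        (Finset.card_erase_lt_of_mem t.2).not_ge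
    choose c hc using hconst
    have hinj : Function.Injective c := by
      intro t t' htt'
      by_contra hne
      obtain ⟨s, hs⟩ : ((T.erase t).erase t').Nonempty := by
        rw [← Finset.card_pos, Finset.card_erase_of_mem, Finset.card_erase_of_mem t.2]
        · lia
        · exact Finset.mem_erase.2 ⟨fun h ↦ hne (Subtype.ext h.symm), t'.2⟩
      simp only [Finset.mem_erase] at hs
      have hall : ∀ z ∈ T, z (c t) = s (c t) := by
        intro z hz
        by_cases hzt : z = t
        · rw [htt']
          exact hc t' z (Finset.mem_erase.2 ⟨fun h ↦ hne (Subtype.ext (hzt.symm.trans h)), hz⟩) s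
            (Finset.mem_erase.2 ⟨hs.1, hs.2.2⟩)
        · exact hc t z (Finset.mem_erase.2 ⟨hzt, hz⟩) s (Finset.mem_erase.2 hs.2)
      obtain ⟨x, hx, y, hy, hxy⟩ := hT (c t)
      exact hxy ((hall x hx).trans (hall y hy).symm)
    have := Fintype.card_le_of_injective c hinj
    simp only [Fintype.card_coe, Fintype.card_fin] at this
    lia
  obtain ⟨x₀, hx₀, -⟩ := hT ⟨0, by lia⟩
  have : Nonempty T := ⟨⟨x₀, hx₀⟩⟩
  obtain ⟨f⟩ := Function.Embedding.nonempty_of_card_le (α := T) (β := Fin k) (by simpa using hcard)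
  have hsurj := Function.invFun_surjective f.injective
  refine ⟨fun a ↦ (Function.invFun f a).1, fun a ↦ hTΔ (Function.invFun f a).2, fun i ↦ ?_⟩
  obtain ⟨x, hx, y, hy, hxy⟩ := hT i
  obtain ⟨a, ha⟩ := hsurj ⟨x, hx⟩
  obtain ⟨b, hb⟩ := hsurj ⟨y, hy⟩
  exact ⟨a, b, by simpa only [ha, hb] using hxy⟩

/-! ### Sets of nonzero entropy -/

lemma coordEntropy_eq_zero_of_const {k : ℕ} {S : Fin k → Type*} [∀ i, Fintype (S i)]
    {Δ : Finset (∀ i, S i)} (p : stdSimplex ℝ Δ) {i : Fin k}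
    (h : ∀ x ∈ Δ, ∀ y ∈ Δ, x i = y i) : coordEntropy p.1 i = 0 := by
  classical
  refine Finset.sum_eq_zero fun α _ ↦ ?_
  by_cases hα : ∀ s : Δ, s.1 i = α
  · have : ∑ s : Δ, p.1 s = 1 := p.2.2
    simp_all
  · obtain ⟨t, ht⟩ := not_forall.1 hα
    rw [Finset.sum_eq_zero, Real.negMulLog_zero]
    intro s hs
    exact absurd ((h _ t.2 _ s.2).trans (by simpa using hs)) ht

lemma coordEntropy_nonneg {k : ℕ} {S : Fin k → Type*} [∀ i, Fintype (S i)]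
    {Δ : Finset (∀ i, S i)} (p : stdSimplex ℝ Δ) (i : Fin k) : 0 ≤ coordEntropy p.1 i := by
  classical
  refine Finset.sum_nonneg fun α _ ↦ Real.negMulLog_nonneg
    (Finset.sum_nonneg fun s _ ↦ p.2.1 s) ?_
  rw [← p.2.2]
  exact Finset.sum_le_sum_of_subset_of_nonneg (Finset.subset_univ _) fun s _ _ ↦ p.2.1 s

lemma exists_ne_of_setEntropy_ne_zero {k : ℕ} {S : Fin k → Type*} [∀ i, Fintype (S i)]
    {Δ : Finset (∀ i, S i)} (h : setEntropy Δ ≠ 0) (i : Fin k) :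
    ∃ x ∈ Δ, ∃ y ∈ Δ, x i ≠ y i := by
  by_contra! hc
  refine h ?_
  have : ∀ p : stdSimplex ℝ Δ, ⨅ i, coordEntropy p.1 i = 0 := fun p ↦ by
    have : Nonempty (Fin k) := ⟨i⟩
    exact le_antisymm ((ciInf_le (Set.finite_range _).bddBelow i).trans_eq
      (coordEntropy_eq_zero_of_const p hc)) (le_ciInf fun j ↦ coordEntropy_nonneg p j)
  simp [setEntropy, this]

/-- For `k = 1` the set of maximal elements is a subsingleton, so its entropy vanishes. -/
lemma two_le_of_setEntropy_maxElements_ne_zero {k : ℕ} (hk : 1 ≤ k) {S : Fin k → Type*}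
    [∀ i, Fintype (S i)] {σ : ∀ i, LinearOrder (S i)} {Γ : Finset (∀ i, S i)}
    (h : setEntropy (maxElements σ Γ) ≠ 0) : 2 ≤ k := by
  by_contra! hlt
  obtain rfl : k = 1 := by lia
  obtain ⟨x, hx, y, hy, hxy⟩ := exists_ne_of_setEntropy_ne_zero h 0
  rw [mem_maxElements] at hx hy
  rcases (σ 0).le_total (x 0) (y 0) with hle | hle
  · exact hxy (congrFun (hx.2 y hy.1 fun i ↦ Subsingleton.elim 0 i ▸ hle) 0).symm
  · exact hxy (congrFun (hy.2 x hx.1 fun i ↦ Subsingleton.elim 0 i ▸ hle) 0)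

/-! ### Counting rearrangements of words -/

lemma card_subtype_add_card_subtype_not {n : ℕ} (P : Fin n → Prop) [Fintype {l // P l}]
    [Fintype {l // ¬ P l}] : Fintype.card {l // P l} + Fintype.card {l // ¬ P l} = n := by
  have h := Fintype.card_subtype_compl P
  have h2 := Fintype.card_subtype_le P
  simp only [Fintype.card_fin] at h h2
  lia

open Classical in
/-- The permutations carrying a word `w` to a given word are at most as many as those that preserve
the set of positions of one letter `c`. -/
lemma card_perm_comp_eq_le {n : ℕ} {α : Type*} (w y : Fin n → α) (c : α)
    [Fintype {l // w l = c}] [Fintype {l // w l ≠ c}] :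
    Fintype.card {g : Equiv.Perm (Fin n) // w ∘ g = y} ≤
      (Fintype.card {l // w l = c}).factorial * (Fintype.card {l // w l ≠ c}).factorial := by
  let f : Fin n → Bool := fun l ↦ decide (w l = c)
  have hstab := DomMulAct.stabilizer_card f
  simp only [Fintype.prod_bool, f, decide_eq_true_eq, decide_eq_false_iff_not] at hstab
  rcases isEmpty_or_nonempty {g : Equiv.Perm (Fin n) // w ∘ g = y} with _ | ⟨⟨g₀, hg₀⟩⟩
  · simp
  · refine le_trans ?_ (hstab.trans (by congr!)).le
    refine Fintype.card_le_of_injective (fun g ↦ ⟨g.1 * g₀⁻¹, ?_⟩) fun g g' hgg' ↦ ?_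
    · ext l
      have h1 : w (g.1 (g₀.symm l)) = w (g₀ (g₀.symm l)) :=
        congrFun (g.2.trans hg₀.symm) (g₀.symm l)
      rw [Equiv.apply_symm_apply] at h1
      simp [h1]
    · exact Subtype.ext (mul_right_cancel (congrArg Subtype.val hgg'))

open Classical in
/-- If the rearrangements of a tuple of words by a common permutation are covered by the sets
`{w | w i ∈ A i}`, then `∑ i, |A i|` is at least the least of the binomial coefficients counting the
possible sets of positions of the letter `c i` in `u i`: a word in `A i` is hit by at most
`n! / (n.choose _)` of the `n!` permutations. -/
theorem le_sum_card_of_forall_perm {n : ℕ} {ι : Type*} [Fintype ι] {S : ι → Type*}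
    (u : ∀ i, Fin n → S i) (c : ∀ i, S i) [∀ i, Fintype {l // u i l = c i}]
    (A : ∀ i, Finset (Fin n → S i))
    (hA : ∀ g : Equiv.Perm (Fin n), ∃ i, u i ∘ g ∈ A i) {M : ℝ}
    (hM : ∀ i, M ≤ n.choose (Fintype.card {l // u i l = c i})) :
    M ≤ ∑ i, ((A i).card : ℝ) := by
  set a : ι → ℕ := fun i ↦ Fintype.card {l // u i l = c i}
  set b : ι → ℕ := fun i ↦ Fintype.card {l // u i l ≠ c i}
  have hab : ∀ i, a i + b i = n := fun i ↦
    card_subtype_add_card_subtype_not fun l ↦ u i l = c i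
  have hcount : n.factorial ≤ ∑ i, (A i).card * ((a i).factorial * (b i).factorial) := by
    calc n.factorial = (Finset.univ : Finset (Equiv.Perm (Fin n))).card := by
          rw [Finset.card_univ, Fintype.card_perm, Fintype.card_fin]
      _ ≤ (Finset.univ.biUnion fun i ↦ (A i).biUnion fun y ↦
            Finset.univ.filter fun g : Equiv.Perm (Fin n) ↦ u i ∘ g = y).card :=
          Finset.card_le_card fun g _ ↦ by simpa using hA g
      _ ≤ ∑ i, (A i).card * ((a i).factorial * (b i).factorial) :=
          Finset.card_biUnion_le.trans <| Finset.sum_le_sum fun i _ ↦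
            Finset.card_biUnion_le_card_mul _ _ _ fun y _ ↦ by
              rw [← Fintype.card_subtype]
              exact card_perm_comp_eq_le (u i) y (c i)
  have hchoose : ∀ i, M * ((a i).factorial * (b i).factorial) ≤ n.factorial := fun i ↦ by
    rw [← Nat.choose_mul_factorial_mul_factorial (Nat.le.intro (hab i)), mul_assoc,
      show n - a i = b i from Nat.sub_eq_of_eq_add' (hab i).symm]
    push_cast
    gcongr
    exact hM i
  have hpos : (0 : ℝ) < n.factorial := by positivity
  rcases le_or_gt M 0 with h0 | h0
  · exact h0.trans (Finset.sum_nonneg fun i _ ↦ by positivity)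
  refine le_of_mul_le_mul_right ?_ hpos
  calc M * n.factorial ≤ M * ∑ i, (A i).card * ((a i).factorial * (b i).factorial) := by
        gcongr
    _ = ∑ i, (A i).card * (M * ((a i).factorial * (b i).factorial)) := by
        push_cast
        rw [Finset.mul_sum]
        refine Finset.sum_congr rfl fun i _ ↦ ?_
        ring
    _ ≤ ∑ i, (A i).card * (n.factorial : ℝ) := by
        gcongr with i _
        exact hchoose i
    _ = _ := by rw [Finset.sum_mul]

lemma div_le_card_periodic {k n : ℕ} (hk : 0 < k) (a : Fin k) {P : Fin n → Prop}
    [Fintype {l // P l}]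
    (hP : ∀ l : Fin n, l.1 % k = a → P l) : n / k ≤ Fintype.card {l // P l} := by
  have hlt : ∀ q : Fin (n / k), q.1 * k + a < n := fun q ↦
    calc q.1 * k + a < (q.1 + 1) * k := by rw [add_mul, one_mul]; exact Nat.add_lt_add_left a.2 _
      _ ≤ n / k * k := Nat.mul_le_mul_right _ q.2
      _ ≤ n := Nat.div_mul_le_self n k
  have := Fintype.card_le_of_injective
    (fun q : Fin (n / k) ↦ (⟨⟨q.1 * k + a, hlt q⟩, hP _ (by
      simp [Nat.mod_eq_of_lt a.2])⟩ : {l // P l}))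
    fun q q' h ↦ by
      have h' : q.1 * k + a = q'.1 * k + a := congrArg (fun x ↦ x.1.1) h
      exact Fin.ext (Nat.eq_of_mul_eq_mul_right hk (by lia))
  simpa using this

/-! ### Binomial coefficients and binary entropy -/

/-- The sequence `j ↦ a ^ j / j!` is largest at `j = a`. -/
lemma factorial_mul_pow_le_factorial_mul_pow (a j : ℕ) :
    a.factorial * a ^ j ≤ j.factorial * a ^ a := by
  rcases le_total a j with h | h
  · obtain ⟨d, rfl⟩ := Nat.exists_eq_add_of_le h
    calc a.factorial * a ^ (a + d) = a.factorial * a ^ d * a ^ a := by ring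
      _ ≤ a.factorial * (a + 1) ^ d * a ^ a := by gcongr; lia
      _ ≤ _ := by gcongr; exact Nat.factorial_mul_pow_le_factorial
  · obtain ⟨d, rfl⟩ := Nat.exists_eq_add_of_le h
    rw [pow_add (j + d) j d, mul_comm ((j + d) ^ j), ← mul_assoc]
    gcongr
    have := Nat.factorial_mul_descFactorial (Nat.le_add_left d j)
    rw [Nat.add_sub_cancel] at this
    rw [← this]
    gcongr
    exact Nat.descFactorial_le_pow _ _

/-- In the binomial expansion of `(a + b) ^ (a + b)` the term at `a` is the largest of the
`a + b + 1` terms. -/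
lemma pow_add_le_choose_mul (a b : ℕ) :
    (a + b) ^ (a + b) ≤ (a + b + 1) * (a + b).choose a * (a ^ a * b ^ b) := by
  have hterm : ∀ m ∈ Finset.range (a + b + 1),
      a ^ m * b ^ (a + b - m) * (a + b).choose m ≤ (a + b).choose a * (a ^ a * b ^ b) := by
    intro m hm
    obtain ⟨i, hi⟩ := Nat.exists_eq_add_of_le (Nat.lt_succ_iff.1 (Finset.mem_range.1 hm))
    have h1 := factorial_mul_pow_le_factorial_mul_pow a m
    have h2 := factorial_mul_pow_le_factorial_mul_pow b i
    have hc1 := Nat.choose_mul_factorial_mul_factorial (Nat.le_add_right a b)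
    have hc2 := Nat.choose_mul_factorial_mul_factorial (Nat.le_add_right m i)
    rw [Nat.add_sub_cancel_left] at hc1 hc2
    rw [hi, Nat.add_sub_cancel_left]
    rw [hi] at hc1
    refine Nat.le_of_mul_le_mul_right (c := a.factorial * b.factorial * (m.factorial * i.factorial))
      ?_ (by positivity)
    calc a ^ m * b ^ i * (m + i).choose m *
          (a.factorial * b.factorial * (m.factorial * i.factorial))
        = (a.factorial * a ^ m) * (b.factorial * b ^ i) *
          ((m + i).choose m * m.factorial * i.factorial) := by ring
      _ ≤ (m.factorial * a ^ a) * (i.factorial * b ^ b) *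
          ((m + i).choose m * m.factorial * i.factorial) := by gcongr
      _ = (m.factorial * a ^ a) * (i.factorial * b ^ b) *
          ((m + i).choose a * a.factorial * b.factorial) := by rw [hc1, hc2]
      _ = _ := by ring
  rw [add_pow]
  refine (Finset.sum_le_card_nsmul _ _ _ hterm).trans_eq ?_
  rw [Finset.card_range, smul_eq_mul, mul_assoc]

lemma exp_mul_binEntropy_le (a b : ℕ) :
    Real.exp ((a + b : ℕ) * Real.binEntropy (a / (a + b : ℕ))) ≤
      ((a + b : ℕ) + 1) * (a + b).choose a := by
  rcases Nat.eq_zero_or_pos (a + b) with h | h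
  · have ha : a = 0 := by lia
    have hb : b = 0 := by lia
    simp [ha, hb]
  set n := a + b with hn
  have hn0 : (0 : ℝ) < n := by exact_mod_cast h
  have hsub : 1 - (a : ℝ) / n = b / n := by
    rw [hn, Nat.cast_add] at hn0 ⊢
    field_simp
    ring
  have hpa : (0 : ℝ) < ((a : ℝ) / n) ^ a := by
    rcases Nat.eq_zero_or_pos a with ha | ha
    · simp [ha]
    · positivity
  have hpb : (0 : ℝ) < ((b : ℝ) / n) ^ b := by
    rcases Nat.eq_zero_or_pos b with hb | hb
    · simp [hb]
    · positivity
  have hexp : n * Real.binEntropy (a / n) =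
      -(Real.log (((a : ℝ) / n) ^ a * ((b : ℝ) / n) ^ b)) := by
    rw [Real.binEntropy_eq_negMulLog_add_negMulLog_one_sub, hsub, Real.log_mul hpa.ne' hpb.ne',
      Real.log_pow, Real.log_pow, Real.negMulLog, Real.negMulLog]
    field_simp
    ring
  rw [hexp, Real.exp_neg, Real.exp_log (mul_pos hpa hpb), inv_le_iff_one_le_mul₀ (mul_pos hpa hpb),
    div_pow, div_pow, div_mul_div_comm, ← pow_add, ← hn, mul_div_assoc', one_le_div (by positivity)]
  exact_mod_cast pow_add_le_choose_mul a b

lemma binEntropy_le_of_le_of_le {p q : ℝ} (hq0 : 0 ≤ q) (hq : q ≤ 2⁻¹) (hqp : q ≤ p)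
    (hp : p ≤ 1 - q) : Real.binEntropy q ≤ Real.binEntropy p := by
  rcases le_total p 2⁻¹ with h | h
  · exact Real.binEntropy_strictMonoOn.monotoneOn ⟨hq0, hq⟩ ⟨hq0.trans hqp, h⟩ hqp
  · rw [← Real.binEntropy_one_sub p]
    exact Real.binEntropy_strictMonoOn.monotoneOn ⟨hq0, hq⟩ ⟨by linarith, by linarith⟩
      (by linarith)

lemma exp_mul_binEntropy_div_le_choose {k n a b : ℕ} (hab : a + b = n)
    (ha : n / k ≤ a) (hb : n / k ≤ b) :
    Real.exp (n * Real.binEntropy ((n / k : ℕ) / n) - Real.log (n + 1)) ≤ n.choose a := by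
  have hn1 : (0 : ℝ) < n + 1 := by positivity
  rw [Real.exp_sub, Real.exp_log hn1, div_le_iff₀ hn1, mul_comm (n.choose a : ℝ)]
  subst hab
  refine le_trans (Real.exp_le_exp.2 ?_) (exp_mul_binEntropy_le a b)
  rcases Nat.eq_zero_or_pos (a + b) with h | h
  · simp [h]
  set n := a + b with hn
  have hn0 : (0 : ℝ) < n := by exact_mod_cast h
  have hnab : (n : ℝ) = a + b := by exact_mod_cast hn
  have ha' : ((n / k : ℕ) : ℝ) ≤ a := by exact_mod_cast ha
  have hb' : ((n / k : ℕ) : ℝ) ≤ b := by exact_mod_cast hb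
  gcongr
  refine binEntropy_le_of_le_of_le (by positivity) ?_ (by gcongr) ?_
  · rw [div_le_iff₀ hn0]
    linarith
  · rw [le_sub_iff_add_le, ← add_div, div_le_one hn0]
    linarith

lemma gapConst_eq_binEntropy {k : ℕ} (hk : 2 ≤ k) : gapConst k = Real.binEntropy (k : ℝ)⁻¹ := by
  have hk' : (2 : ℝ) ≤ k := by exact_mod_cast hk
  have h1 : (0 : ℝ) < k - 1 := by linarith
  have h2 : 1 - (k : ℝ)⁻¹ = (k - 1) / k := by field_simp
  rw [gapConst, Real.log_div (by positivity) (by positivity), Real.log_rpow h1,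
    Real.binEntropy_eq_negMulLog_add_negMulLog_one_sub, h2, Real.negMulLog, Real.negMulLog,
    Real.log_inv, Real.log_div h1.ne' (by positivity)]
  field_simp
  ring

lemma tendsto_natDiv_div_atTop (k : ℕ) :
    Tendsto (fun n : ℕ ↦ ((n / k : ℕ) : ℝ) / n) atTop (nhds (k : ℝ)⁻¹) := by
  refine ((tendsto_nat_floor_mul_div_atTop (R := ℝ) (a := (k : ℝ)⁻¹) (by positivity)).comp
    tendsto_natCast_atTop_atTop).congr fun n ↦ ?_
  simp only [Function.comp_apply]
  rw [inv_mul_eq_div, Nat.floor_div_eq_div]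

lemma isLittleO_log_natCast_add_one :
    (fun n : ℕ ↦ Real.log (n + 1)) =o[atTop] fun n : ℕ ↦ (n : ℝ) := by
  have h1 : Tendsto (fun n : ℕ ↦ (n : ℝ) + 1) atTop atTop :=
    tendsto_atTop_add_const_right _ _ tendsto_natCast_atTop_atTop
  refine (Real.isLittleO_log_id_atTop.comp_tendsto h1).trans_isBigO ?_
  refine IsBigO.of_bound 2 ?_
  filter_upwards [eventually_ge_atTop 1] with n hn
  have : (1 : ℝ) ≤ n := by exact_mod_cast hn
  simp only [Function.comp_apply, id, Real.norm_eq_abs]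
  rw [abs_of_nonneg (by positivity), abs_of_nonneg (by positivity)]
  linarith

/-! ### The gap theorem -/

theorem mainTheorem4 {k : ℕ} (hk : 1 ≤ k) {F : Type*} [Field F] {V : Fin k → Type*}
    [∀ i, AddCommGroup (V i)] [∀ i, Module F (V i)]
    {S : Fin k → Type*} [∀ i, Fintype (S i)] (B : ∀ i, Module.Basis (S i) F (V i))
    (v : ⨂[F] i, V i)
    (h : ∃ σ : ∀ i, LinearOrder (S i), setEntropy (maxElements σ (tensorSupport B v)) ≠ 0) :
    ∃ e : ℕ → ℝ, e =o[atTop] (fun n : ℕ => (n : ℝ)) ∧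
      ∀ n : ℕ, Real.exp (gapConst k * ((n : ℝ) + e n)) ≤ (sliceRank (kTensorPow v n) : ℝ) := by
  classical
  obtain ⟨σ, hσ⟩ := h
  have hk2 := two_le_of_setEntropy_maxElements_ne_zero hk hσ
  obtain ⟨f, hfΔ, hf⟩ := exists_fin_family_nonconstant hk2 (exists_ne_of_setEntropy_ne_zero hσ)
  have hξ : 0 < gapConst k := by
    rw [gapConst_eq_binEntropy hk2]
    exact Real.binEntropy_pos (by positivity)
      (inv_lt_one_of_one_lt₀ (by exact_mod_cast hk2))
  -- The bound obtained is `exp (n * binEntropy (⌊n / k⌋ / n)) / (n + 1)`; solve for `e n`.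
  refine ⟨fun n ↦ (n * Real.binEntropy ((n / k : ℕ) / n) - Real.log (n + 1)) / gapConst k - n,
    ?_, fun n ↦ ?_⟩
  · have h1 := (Real.binEntropy_continuous.tendsto _).comp (tendsto_natDiv_div_atTop k)
    have h2 := (((h1.sub isLittleO_log_natCast_add_one.tendsto_div_nhds_zero).div_const
      (gapConst k)).sub_const 1)
    rw [sub_zero, ← gapConst_eq_binEntropy hk2, div_self hξ.ne', sub_self] at h2
    refine (isLittleO_iff_tendsto' ?_).2 (h2.congr' ?_)
    · filter_upwards [eventually_ne_atTop 0] with n hn h0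
      exact absurd h0 (by exact_mod_cast hn)
    · filter_upwards [eventually_ne_atTop 0] with n hn
      have hn' : (n : ℝ) ≠ 0 := by exact_mod_cast hn
      simp only [Function.comp_apply]
      field_simp
  · rw [add_sub_cancel, mul_div_cancel₀ _ hξ.ne']
    obtain ⟨A, hcard, hA⟩ := exists_cover_card_le_sliceRank hk
      (fun i ↦ lexLinearOrder (σ i) n) (fun i ↦ tensorPowerBasis (B i) n) (kTensorPow v n)
    choose a b hab using hf
    -- The word repeating `f 0, …, f (k - 1)` periodically; in each coordinate `i` the values of
    -- `f (a i)` and `f (b i)` are distinct letters that both occur at least `n / k` times.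
    let r : Fin n → Fin k := fun l ↦ ⟨l % k, Nat.mod_lt _ hk⟩
    refine le_trans (le_sum_card_of_forall_perm (fun i l ↦ f (r l) i) (fun i ↦ f (a i) i) A
      (fun g ↦ hA _ (mem_maxElements_lex σ (mem_tensorSupport_kTensorPow B v n)
        fun l ↦ hfΔ (r (g l)))) fun i ↦ ?_) (by exact_mod_cast hcard)
    refine exp_mul_binEntropy_div_le_choose (b := Fintype.card {l // f (r l) i ≠ f (a i) i})
      ?_ ?_ ?_
    · exact card_subtype_add_card_subtype_not fun l ↦ f (r l) i = f (a i) i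
    · refine div_le_card_periodic hk (a i) fun l hl ↦ ?_
      rw [show r l = a i from Fin.ext hl]
    · refine div_le_card_periodic hk (b i) fun l hl ↦ ?_
      rw [show r l = b i from Fin.ext hl]
      exact (hab i).symm
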